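/- Let $\mathbb{T}=\{z\in\mathbb{C}:|z|=1\}$ and let $m_d$ denote the Haar measure of the torus $\mathbb{T}^d$, normalized by $m_d(\mathbb{T}^d)=1$. For $1\le p<\infty$, the Hardy space $H^p(\mathbb{T}^d)$ is the subspace of $L^p(\mathbb{T}^d)=L^p(\mathbb{T}^d,m_d)$ consisting of those $f$ with $\int_{\mathbb{T}^d} f(z)\,\overline{z^\alpha}\,dm_d(z)=0$ for every $\alpha\in\mathbb{Z}^d\setminus\{0,1,2,\ldots\}^d$, equipped with the norm $\|f\|_{H^p(\mathbb{T}^d)}=\left(\int_{\mathbb{T}^d}|f|^p\,dm_d\right)^{1/p}$. Theorem (Khintchin's inequality for Steinhaus variables). Fix $2<p<\infty$. For every $d\ge 1$ and all complex numbers $c_1,\ldots,c_d$, the function $z\mapsto\sum_{j=1}^d c_j z_j$ belongs to $H^p(\mathbb{T}^d)$ and \[\Bigg\|\sum_{j=1}^d c_j z_j\Bigg\|_{H^p(\mathbb{T}^d)}\le \Gamma\left(1+\frac p2\right)^{1/p}\Bigg(\sum_{j=1}^d|c_j|^2\Bigg)^{1/2}.\] The constant $\Gamma(1+p/2)^{1/p}$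 is optimal: if $C$ is a real number such that $\left\|\sum_{j=1}^d c_j z_j\right\|_{H^p(\mathbb{T}^d)}\le C\left(\sum_{j=1}^d|c_j|^2\right)^{1/2}$ for every $d\ge1$ and all complex $c_1,\ldots,c_d$, then $C\ge\Gamma(1+p/2)^{1/p}$. -/

import Mathlib

open MeasureTheory
open scoped ENNReal

/-- The unit circle `𝕋 = {z ∈ ℂ : |z| = 1}` carries its Borel σ-algebra. -/
noncomputable instance instMeasurableSpaceCircleBorel : MeasurableSpace Circle := borel Circle

instance instBorelSpaceCircleBorel : BorelSpace Circle := ⟨rfl⟩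

/-- The normalized arc length measure `m_1` on `𝕋`: Haar measure with total mass one. -/
noncomputable def circleMeasure : Measure Circle :=
  Measure.haarMeasure (⊤ : TopologicalSpace.PositiveCompacts Circle)

instance instIsHaarMeasureCircleMeasure : circleMeasure.IsHaarMeasure := by
  unfold circleMeasure; infer_instance

instance instIsProbabilityMeasureCircleMeasure : IsProbabilityMeasure circleMeasure := by
  constructor
  have h := Measure.haarMeasure_self (K₀ := (⊤ : TopologicalSpace.PositiveCompacts Circle))
  simpa [circleMeasure] using h

/-- The measure `m_d` on the `d`-dimensional torus `𝕋^d`. -/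
noncomputable def torusMeasure (d : ℕ) : Measure (Fin d → Circle) :=
  Measure.pi fun _ => circleMeasure

/-- `m_d` is the Haar measure of the compact group `𝕋^d`, normalized to total mass one
(the two instances here). -/
instance instIsHaarMeasureTorusMeasure (d : ℕ) : (torusMeasure d).IsHaarMeasure := by
  unfold torusMeasure; infer_instance

instance instIsProbabilityMeasureTorusMeasure (d : ℕ) :
    IsProbabilityMeasure (torusMeasure d) := by
  unfold torusMeasure; infer_instance

/-- The monomial `z^α = z_1^{α_1} ⋯ z_d^{α_d}` on `𝕋^d`, for `α ∈ ℤ^d`. -/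
noncomputable def torusMonomial {d : ℕ} (α : Fin d → ℤ) (z : Fin d → Circle) : ℂ :=
  ∏ j, (z j : ℂ) ^ α j

/-- The Fourier coefficient `∫_{𝕋^d} f(z) conj(z^α) dm_d(z)`. -/
noncomputable def torusFourierCoeff {d : ℕ} (f : (Fin d → Circle) → ℂ) (α : Fin d → ℤ) : ℂ :=
  ∫ z, f z * (starRingEnd ℂ) (torusMonomial α z) ∂torusMeasure d

/-- `f` belongs to the Hardy space `H^p(𝕋^d)`: it is in `L^p(𝕋^d)` and its Fourier coefficients
vanish at every `α ∈ ℤ^d` with at least one negative entry. -/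
def MemHardy {d : ℕ} (f : (Fin d → Circle) → ℂ) (p : ℝ≥0∞) : Prop :=
  MemLp f p (torusMeasure d) ∧
    ∀ α : Fin d → ℤ, (∃ j, α j < 0) → torusFourierCoeff f α = 0

/-- The norm of `H^p(𝕋^d)`, which is that of `L^p(𝕋^d)`. It is used for `f` in `H^p(𝕋^d)`. -/
noncomputable def hardyNorm {d : ℕ} (f : (Fin d → Circle) → ℂ) (p : ℝ≥0∞) : ℝ :=
  (eLpNorm f p (torusMeasure d)).toReal

/-- The `1`-homogeneous polynomial `φ(z) = c_1 z_1 + ⋯ + c_d z_d`, as a function on `𝕋^d`. -/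
noncomputable def linearPoly {d : ℕ} (c : Fin d → ℂ) (z : Fin d → Circle) : ℂ :=
  ∑ j, c j * (z j : ℂ)

open Filter Topology

/-! The extremal variable is the standard complex Gaussian `g`, normalized by `E|g|² = 1`, for which
`E|g|^p = Γ(1 + p/2)`. A combination `∑ c_j g_j` of independent copies has the law of `(∑
|c_j|²)^{1/2} g`, so the inequality follows once every Steinhaus variable may be replaced by a
Gaussian without decreasing the `p`-th moment.

For one variable, `g` has the law of `|g| ζ` with `ζ` uniform on the circle and independent of
`|g|`. If `s ↦ E|a + c √s ζ|^p` is convex, Jensen's inequality applied to `s = |g|²`, whose mean is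
1, gives the comparison (`integral_circle_le_integral_complexGaussian`). Tonelli's theorem and
induction on `d`, with a free shift `a`, handle several variables.

The crux is this convexity (`convexOn_circleMoment`). Scaling and rotation reduce it to `E|1 + √s
ζ|^p`. For `s < 1` Parseval gives the power series `∑ binom(p/2, k)² s^k`, with nonnegative
coefficients. For `s > 1` inversion gives `∑ binom(p/2, k)² s^{p/2-k}`, in which at most one term
fails to be convex; its predecessor compensates for it. The two halves are glued at `s = 1`, where
the derivative is continuous.

Sharpness comes from the central limit theorem with all `c_j = n^{-1/2}`. -/

/-! ### Fourier analysis on the circle -/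

theorem Continuous.integrable_circle {E : Type*} [NormedAddCommGroup E] {f : Circle → E}
    (hf : Continuous f) : Integrable f circleMeasure := by
  rw [← integrableOn_univ]
  exact hf.continuousOn.integrableOn_compact isCompact_univ

/-- Rotation by `u` multiplies the integral by `u ^ n`. With `u = exp(i/n)` this factor is `exp(i)`,
which is not 1 because 1 is not an integer multiple of `2π`. -/
theorem integral_circle_zpow {n : ℤ} (hn : n ≠ 0) :
    ∫ z : Circle, (z : ℂ) ^ n ∂circleMeasure = 0 := by
  obtain ⟨u, hu⟩ : ∃ u : Circle, (u : ℂ) ^ n ≠ 1 := by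
    refine ⟨Circle.exp (1 / n), fun h ↦ ?_⟩
    have hn' : (n : ℂ) ≠ 0 := by exact_mod_cast hn
    rw [Circle.coe_exp, ← Complex.exp_int_mul, Complex.exp_eq_one_iff] at h
    obtain ⟨m, hm⟩ := h
    push_cast at hm
    have h2 : (1 : ℂ) = m * (2 * Real.pi) := by
      have : (n : ℂ) * (1 / n * Complex.I) = Complex.I := by field_simp
      rw [this] at hm
      apply mul_right_cancel₀ Complex.I_ne_zero
      linear_combination hm
    have h3 : (1 : ℝ) = m * (2 * Real.pi) := by exact_mod_cast h2
    have h4 := Real.pi_gt_three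
    rcases lt_trichotomy m 0 with hm0 | rfl | hm0
    · have : (m : ℝ) < 0 := by exact_mod_cast hm0
      nlinarith
    · simp at h3
    · have : (1 : ℝ) ≤ m := by exact_mod_cast hm0
      nlinarith
  have h := integral_mul_left_eq_self (μ := circleMeasure) (fun z : Circle ↦ (z : ℂ) ^ n) u
  simp only [Circle.coe_mul, mul_zpow] at h
  rw [integral_const_mul] at h
  have : ((u : ℂ) ^ n - 1) * ∫ z : Circle, (z : ℂ) ^ n ∂circleMeasure = 0 := by
    linear_combination h
  exact (mul_eq_zero.1 this).resolve_left (sub_ne_zero.2 hu)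

theorem Circle.conj_pow_eq_zpow (z : Circle) (n : ℕ) :
    (starRingEnd ℂ) ((z : ℂ) ^ n) = (z : ℂ) ^ (-(n : ℤ)) := by
  rw [map_pow, ← Circle.coe_inv_eq_conj, Circle.coe_inv, zpow_neg, inv_pow, zpow_natCast]

theorem integral_circle_pow_mul_conj_pow (m n : ℕ) :
    ∫ z : Circle, (z : ℂ) ^ m * (starRingEnd ℂ) ((z : ℂ) ^ n) ∂circleMeasure =
      if m = n then 1 else 0 := by
  have h (z : Circle) : (z : ℂ) ^ m * (starRingEnd ℂ) ((z : ℂ) ^ n) = (z : ℂ) ^ ((m : ℤ) - n) := by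
    rw [Circle.conj_pow_eq_zpow, sub_eq_add_neg, zpow_add₀ (Circle.coe_ne_zero z), zpow_natCast]
  simp_rw [h]
  split_ifs with hmn
  · simp [hmn]
  · exact integral_circle_zpow (by omega)

/-- The Parseval identity for absolutely convergent power series on the unit circle. -/
theorem hasSum_integral_circle_norm_sq {a : ℕ → ℂ} (ha : Summable fun k ↦ ‖a k‖) :
    HasSum (fun k ↦ ‖a k‖ ^ 2)
      (∫ z : Circle, ‖∑' k, a k * (z : ℂ) ^ k‖ ^ 2 ∂circleMeasure) := by
  have hc : Continuous fun z : Circle ↦ ∑' k, a k * (z : ℂ) ^ k :=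
    continuous_tsum (fun k ↦ by fun_prop) ha (by simp [Circle.norm_coe])
  set f : Circle → ℂ := fun z ↦ ∑' k, a k * (z : ℂ) ^ k with hf
  have hcoef (k : ℕ) : ∫ z : Circle, (z : ℂ) ^ k * (starRingEnd ℂ) (f z) ∂circleMeasure =
      (starRingEnd ℂ) (a k) := by
    have h1 (z : Circle) : (z : ℂ) ^ k * (starRingEnd ℂ) (f z) =
        ∑' j, (starRingEnd ℂ) (a j) * ((z : ℂ) ^ k * (starRingEnd ℂ) ((z : ℂ) ^ j)) := by
      rw [hf, Complex.conj_tsum, ← tsum_mul_left]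
      exact tsum_congr fun j ↦ by rw [map_mul]; ring
    have h2 := hasSum_integral_of_summable_integral_norm (μ := circleMeasure)
      (F := fun j (z : Circle) ↦
        (starRingEnd ℂ) (a j) * ((z : ℂ) ^ k * (starRingEnd ℂ) ((z : ℂ) ^ j)))
      (fun j ↦ Continuous.integrable_circle (by fun_prop)) (by simpa [Circle.norm_coe] using ha)
    simp_rw [integral_const_mul, integral_circle_pow_mul_conj_pow, ← h1] at h2
    refine h2.unique ?_
    have h3 : (fun j ↦ (starRingEnd ℂ) (a j) * if k = j then 1 else 0) =
        fun j ↦ if j = k then (starRingEnd ℂ) (a k) else 0 := by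
      funext j
      by_cases hj : k = j
      · simp [hj]
      · simp [hj, Ne.symm hj]
    rw [h3]
    exact hasSum_ite_eq k _
  have hb : ∀ z, ‖f z‖ ≤ ∑' k, ‖a k‖ := fun z ↦ by
    refine (norm_tsum_le_tsum_norm ?_).trans (le_of_eq (by simp [Circle.norm_coe]))
    simpa [Circle.norm_coe] using ha
  have h3 := hasSum_integral_of_summable_integral_norm (μ := circleMeasure)
      (F := fun j (z : Circle) ↦ a j * ((z : ℂ) ^ j * (starRingEnd ℂ) (f z)))
      (fun j ↦ Continuous.integrable_circle (by fun_prop)) (by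
        refine Summable.of_nonneg_of_le (fun j ↦ integral_nonneg fun z ↦ norm_nonneg _)
          (fun j ↦ ?_) (ha.mul_right (∑' k, ‖a k‖))
        refine (integral_mono (Continuous.integrable_circle (by fun_prop)) (integrable_const _)
          (fun z ↦ ?_)).trans (le_of_eq (integral_const (‖a j‖ * ∑' k, ‖a k‖)) |>.trans (by simp))
        simpa [Circle.norm_coe] using mul_le_mul_of_nonneg_left (hb z) (norm_nonneg (a j)))
  simp_rw [integral_const_mul, hcoef] at h3
  have h4 (z : Circle) : ∑' j, a j * ((z : ℂ) ^ j * (starRingEnd ℂ) (f z)) =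
      ((‖f z‖ ^ 2 : ℝ) : ℂ) := by
    simp_rw [← mul_assoc]
    rw [tsum_mul_right, Complex.ofReal_pow, ← Complex.mul_conj']
  simp_rw [h4, Complex.mul_conj'] at h3
  rw [integral_complex_ofReal] at h3
  exact_mod_cast h3

/-! ### Convexity of the circular moment in the squared radius -/

/-- The `p`-th moment of `1 + √s ζ`, with `ζ` uniformly distributed on the unit circle. -/
noncomputable def circleMoment (p s : ℝ) : ℝ :=
  ∫ z : Circle, ‖1 + (√s : ℂ) * z‖ ^ p ∂circleMeasure

/-- Parseval applied to the binomial series of `(1 + w)^{p/2}`, since `|1 + w|^p = |(1 +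
w)^{p/2}|²`. -/
theorem hasSum_circleMoment {p s : ℝ} (hs0 : 0 ≤ s) (hs1 : s < 1) :
    HasSum (fun k ↦ (Ring.choose (p / 2) k) ^ 2 * s ^ k) (circleMoment p s) := by
  have hr1 : √s < 1 := by rwa [Real.sqrt_lt' one_pos, one_pow]
  have hser := Complex.one_add_cpow_hasFPowerSeriesOnBall_zero (a := ((p / 2 : ℝ) : ℂ))
  have hmem (z : ℂ) (hz : ‖z‖ < 1) : z ∈ Metric.eball (0 : ℂ) 1 := by
    simpa [← ofReal_norm] using hz
  have hsum (z : ℂ) (hz : ‖z‖ < 1) : HasSum (fun k ↦ ((Ring.choose (p / 2) k : ℝ) : ℂ) * z ^ k)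
      ((1 + z) ^ ((p / 2 : ℝ) : ℂ)) := by
    have := hser.hasSum (hmem z hz)
    simpa [binomialSeries, mul_comm, Complex.ofReal_choose] using this
  have hn : Summable fun k ↦ ‖((Ring.choose (p / 2) k : ℝ) : ℂ) * (√s : ℂ) ^ k‖ := by
    exact (hsum (√s : ℂ) (by simpa [abs_of_nonneg (Real.sqrt_nonneg s)] using hr1)).summable.norm
  have h := hasSum_integral_circle_norm_sq hn
  have h2 : ∀ k, ‖((Ring.choose (p / 2) k : ℝ) : ℂ) * (√s : ℂ) ^ k‖ ^ 2 =
      (Ring.choose (p / 2) k) ^ 2 * s ^ k := fun k ↦ by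
    rw [norm_mul, mul_pow, norm_pow, Complex.norm_real, Complex.norm_real, Real.norm_eq_abs,
      Real.norm_eq_abs, sq_abs, pow_right_comm, sq_abs, Real.sq_sqrt hs0]
  simp_rw [h2] at h
  convert h using 1
  refine integral_congr_ae (.of_forall fun z ↦ ?_)
  have h3 := (hsum ((√s : ℂ) * z)
    (by simpa [abs_of_nonneg (Real.sqrt_nonneg s), Circle.norm_coe] using hr1)).tsum_eq
  simp only [mul_assoc, ← mul_pow]
  rw [h3, Complex.norm_cpow_real, ← Real.rpow_natCast, ← Real.rpow_mul (norm_nonneg _)]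
  norm_num

/-- Inversion `z ↦ z⁻¹` preserves Haar measure, and `1 + √s z⁻¹ = √s z⁻¹ (1 + z/√s)`. This carries
the expansion for `s < 1` over to `s > 1`. -/
theorem circleMoment_eq_rpow_mul {p s : ℝ} (hs : 0 < s) :
    circleMoment p s = s ^ (p / 2) * circleMoment p s⁻¹ := by
  have h := integral_inv_eq_self (μ := circleMeasure)
    (fun z : Circle ↦ ‖1 + (√s : ℂ) * z‖ ^ p)
  rw [circleMoment, ← h, circleMoment, ← integral_const_mul]
  refine integral_congr_ae (.of_forall fun z ↦ ?_)
  have h0 : (√s : ℂ) ≠ 0 := by exact_mod_cast (Real.sqrt_pos.2 hs).ne'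
  have h1 : ‖1 + (√s : ℂ) * (z⁻¹ : Circle)‖ = √s * ‖1 + (√s⁻¹ : ℂ) * z‖ := by
    have hz := Circle.coe_ne_zero z
    have : 1 + (√s : ℂ) * (z⁻¹ : Circle) = √s * (z⁻¹ : Circle) * (1 + (√s⁻¹ : ℂ) * z) := by
      rw [Circle.coe_inv, Real.sqrt_inv]
      push_cast
      field_simp
      ring
    rw [this, norm_mul, norm_mul, Circle.norm_coe, Complex.norm_real, Real.norm_eq_abs,
      abs_of_nonneg (Real.sqrt_nonneg s), mul_one]
  simp only [h1]
  rw [Real.mul_rpow (Real.sqrt_nonneg s) (norm_nonneg _), Real.sqrt_eq_rpow, ← Real.rpow_mul hs.le]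
  congr 2
  ring

theorem Ring.choose_succ_mul (q : ℝ) (k : ℕ) :
    Ring.choose q (k + 1) * (k + 1) = Ring.choose q k * (q - k) := by
  rw [Ring.choose_eq_smul, Ring.choose_eq_smul, descPochhammer_succ_right, Polynomial.smeval_mul,
    Nat.factorial_succ]
  have : ((k.factorial : ℕ) : ℝ) ≠ 0 := by positivity
  simp only [Polynomial.smeval_sub, Polynomial.smeval_X, Polynomial.smeval_natCast, smul_eq_mul,
    pow_one, pow_zero, nsmul_eq_mul, mul_one, Nat.cast_mul]
  push_cast
  field_simp

theorem convexOn_of_hasSum {S : Set ℝ} {g : ℕ → ℝ → ℝ} {f : ℝ → ℝ} (hS : Convex ℝ S)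
    (hg : ∀ k, ConvexOn ℝ S (g k)) (hf : ∀ x ∈ S, HasSum (fun k ↦ g k x) (f x)) :
    ConvexOn ℝ S f := by
  refine ⟨hS, fun x hx y hy a b ha hb hab ↦ ?_⟩
  refine hasSum_le (fun k ↦ (hg k).2 hx hy ha hb hab) (hf _ (hS hx hy ha hb hab)) ?_
  exact ((hf x hx).const_smul a).add ((hf y hy).const_smul b)

/-- The second derivative is `s^{e-2}` times an affine function of `s`. The hypotheses say that this
function has nonnegative slope and a nonnegative value at `s = 1`. -/
theorem convexOn_rpow_add_rpow {A B e : ℝ} (h1 : 0 ≤ (e + 1) * e * A)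
    (h2 : 0 ≤ (e + 1) * e * A + e * (e - 1) * B) :
    ConvexOn ℝ (Set.Ioi 1) fun s : ℝ ↦ A * s ^ (e + 1) + B * s ^ e := by
  have hd (c : ℝ) {s : ℝ} (hs : s ∈ Set.Ioi (1 : ℝ)) :
      HasDerivAt (fun s : ℝ ↦ s ^ c) (c * s ^ (c - 1)) s :=
    Real.hasDerivAt_rpow_const (Or.inl (by linarith [Set.mem_Ioi.1 hs]))
  have hd1 {s : ℝ} (hs : s ∈ Set.Ioi (1 : ℝ)) :
      HasDerivAt (fun s : ℝ ↦ A * s ^ (e + 1) + B * s ^ e)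
        (A * ((e + 1) * s ^ e) + B * (e * s ^ (e - 1))) s := by
    have := ((hd (e + 1) hs).const_mul A).add ((hd e hs).const_mul B)
    rwa [add_sub_cancel_right] at this
  have hd2 {s : ℝ} (hs : s ∈ Set.Ioi (1 : ℝ)) :
      HasDerivAt (fun s : ℝ ↦ A * ((e + 1) * s ^ e) + B * (e * s ^ (e - 1)))
        (A * ((e + 1) * (e * s ^ (e - 1))) + B * (e * ((e - 1) * s ^ (e - 1 - 1)))) s :=
    (((hd e hs).const_mul (e + 1)).const_mul A).add (((hd (e - 1) hs).const_mul e).const_mul B)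
  refine convexOn_of_hasDerivWithinAt2_nonneg (convex_Ioi 1)
    (fun s hs ↦ (hd1 hs).continuousAt.continuousWithinAt)
    (fun s hs ↦ (hd1 (by simpa using hs)).hasDerivWithinAt)
    (fun s hs ↦ (hd2 (by simpa using hs)).hasDerivWithinAt) fun s hs ↦ ?_
  have hs1 : 1 < s := by simpa using hs
  have hs0 : 0 < s := by linarith
  have h3 : s ^ (e - 1) = s ^ (e - 1 - 1) * s := by
    rw [← Real.rpow_add_one hs0.ne', sub_add_cancel]
  rw [h3]
  have h4 : 0 < s ^ (e - 1 - 1) := Real.rpow_pos_of_pos hs0 _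
  have h5 : 0 ≤ (e + 1) * e * A * s + e * (e - 1) * B := by nlinarith
  have := mul_nonneg h4.le h5
  linarith

theorem convexOn_circleMoment_Ioo (p : ℝ) : ConvexOn ℝ (Set.Ioo 0 1) (circleMoment p) := by
  refine convexOn_of_hasSum (convex_Ioo 0 1)
    (g := fun k s ↦ (Ring.choose (p / 2) k) ^ 2 * s ^ k) (fun k ↦ ?_)
    (fun s hs ↦ hasSum_circleMoment hs.1.le hs.2)
  exact ((convexOn_pow k).subset (fun s hs ↦ hs.1.le) (convex_Ioo 0 1)).smul (sq_nonneg _)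

theorem hasSum_circleMoment_of_one_lt {p s : ℝ} (hs : 1 < s) :
    HasSum (fun k : ℕ ↦ (Ring.choose (p / 2) k) ^ 2 * s ^ (p / 2 - k)) (circleMoment p s) := by
  have hs0 : 0 < s := by linarith
  rw [circleMoment_eq_rpow_mul hs0]
  have h := (hasSum_circleMoment (p := p) (inv_nonneg.2 hs0.le) (inv_lt_one_of_one_lt₀ hs)).mul_left
    (s ^ (p / 2))
  convert! h using 2 with k
  rw [Real.rpow_sub hs0, Real.rpow_natCast, inv_pow]
  ring

/-- With `q = p/2`, the power `s^{q-k}` is convex unless `0 < q - k < 1`, which can happen only for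
`k = ⌊q⌋ = m + 1`. Here `m ≥ 0` because `q > 1`, so that term can be grouped with the one at `k =
m`. -/
theorem convexOn_circleMoment_Ioi {p : ℝ} (hp : 2 < p) :
    ConvexOn ℝ (Set.Ioi 1) (circleMoment p) := by
  set q := p / 2 with hq
  have hq1 : 1 < q := by rw [hq]; linarith
  obtain ⟨m, hm⟩ : ∃ m : ℕ, ⌊q⌋₊ = m + 1 :=
    Nat.exists_eq_succ_of_ne_zero (Nat.floor_pos.2 hq1.le).ne'
  have hm1 : (m : ℝ) + 1 ≤ q := by
    have := Nat.floor_le (show 0 ≤ q by linarith)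
    rw [hm] at this
    exact_mod_cast this
  have hm2 : q < m + 2 := by
    have := Nat.lt_floor_add_one q
    rw [hm] at this
    push_cast at this
    linarith
  set g : ℕ → ℝ → ℝ := fun k s ↦ (Ring.choose q k) ^ 2 * s ^ (q - k) with hg
  have hsingle {k : ℕ} (hk : 0 ≤ (q - k) * (q - k - 1)) : ConvexOn ℝ (Set.Ioi 1) (g k) := by
    have := convexOn_rpow_add_rpow (A := 0) (B := (Ring.choose q k) ^ 2) (e := q - k) (by simp)
      (by simpa using mul_nonneg hk (sq_nonneg _))
    simpa using this
  have hpair : ConvexOn ℝ (Set.Ioi 1) (g m + g (m + 1)) := by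
    have hc := Ring.choose_succ_mul q m
    have hf0 : 0 ≤ q - (m + 1) := by linarith
    have hf1 : q - (m + 1) < 1 := by linarith
    set f := q - (m + 1) with hf
    have hqm : q - m = f + 1 := by rw [hf]; ring
    rw [hqm] at hc
    -- With `A` and `B` the squared coefficients at `m` and `m + 1`, the recursion and `m + 1 ≥ 1`
    -- give `B ≤ A (1 + f)²`. Hence the second derivative at 1 satisfies `f(1+f)A - f(1-f)B ≥
    -- f³(1+f)A ≥ 0`.
    have hB : (Ring.choose q (m + 1)) ^ 2 ≤ (Ring.choose q m) ^ 2 * (f + 1) ^ 2 := by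
      rw [← mul_pow, ← hc, mul_pow]
      refine le_mul_of_one_le_right (sq_nonneg _) ?_
      have : (0 : ℝ) ≤ m := by positivity
      nlinarith
    have h1 : 0 ≤ (f + 1) * f * (Ring.choose q m) ^ 2 := by positivity
    have := convexOn_rpow_add_rpow (A := (Ring.choose q m) ^ 2) (B := (Ring.choose q (m + 1)) ^ 2)
      (e := f) h1 (by
        have h2 : f * (1 - f) * (Ring.choose q (m + 1)) ^ 2 ≤
            f * (1 - f) * ((Ring.choose q m) ^ 2 * (f + 1) ^ 2) :=
          mul_le_mul_of_nonneg_left hB (mul_nonneg hf0 (by linarith))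
        have h3 : 0 ≤ (f + 1) * f * (Ring.choose q m) ^ 2 * f ^ 2 := by positivity
        linarith)
    convert this using 1
    funext s
    simp only [hg, Pi.add_apply, Nat.cast_add, Nat.cast_one, hqm, hf]
  -- Adding a sequence with sum zero moves the term of index `m + 1` into index `m`, so that every
  -- term of the new series is convex.
  have hsum (s : ℝ) (hs : s ∈ Set.Ioi (1 : ℝ)) :
      HasSum (fun k ↦ g k s + ((Pi.single m (g (m + 1) s) : ℕ → ℝ) k -
        (Pi.single (m + 1) (g (m + 1) s) : ℕ → ℝ) k)) (circleMoment p s) := by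
    have := (hasSum_circleMoment_of_one_lt (p := p) hs).add
      ((hasSum_pi_single m (g (m + 1) s)).sub (hasSum_pi_single (m + 1) (g (m + 1) s)))
    rwa [sub_self, add_zero] at this
  refine convexOn_of_hasSum (convex_Ioi 1) (fun k ↦ ?_) hsum
  rcases lt_trichotomy k m with hk | rfl | hk
  · have hk' : (k : ℝ) + 1 ≤ m := by exact_mod_cast hk
    have h1 : k ≠ m := by omega
    have h2 : k ≠ m + 1 := by omega
    simpa [Pi.single_apply, h1, h2] using
      hsingle (k := k) (mul_nonneg (by linarith) (by linarith))
  · simpa [Pi.single_apply] using! hpair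
  · rcases eq_or_ne k (m + 1) with rfl | hk1
    · simpa [Pi.single_apply] using convexOn_const (0 : ℝ) (convex_Ioi (1 : ℝ))
    · have hk' : (m : ℝ) + 2 ≤ k := by exact_mod_cast (show m + 2 ≤ k by omega)
      have h1 : k ≠ m := by omega
      simpa [Pi.single_apply, h1, hk1] using
        hsingle (k := k) (mul_nonneg_of_nonpos_of_nonpos (by linarith) (by linarith))

theorem continuous_integral_circle {X E : Type*} [TopologicalSpace X] [FirstCountableTopology X]
    [LocallyCompactSpace X] [NormedAddCommGroup E] [NormedSpace ℝ E] {f : X → Circle → E}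
    (hf : Continuous f.uncurry) : Continuous fun x ↦ ∫ z, f x z ∂circleMeasure := by
  simpa using continuous_parametric_integral_of_continuous (μ := circleMeasure) hf isCompact_univ

theorem continuous_circleMoment {p : ℝ} (hp : 0 ≤ p) : Continuous (circleMoment p) := by
  refine continuous_integral_circle ?_
  refine Continuous.rpow_const ?_ fun _ ↦ Or.inr hp
  fun_prop

/-- The integrand is C¹ in the radius `r = √s`, because `‖·‖ ^ p` is C¹ for `p > 1`; the chain rule
then passes to `s > 0`. Continuity of `F'` is what permits gluing at `s = 1`. -/
theorem hasDerivAt_circleMoment {p : ℝ} (hp : 1 < p) :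
    ∃ F' : ℝ → ℝ, Continuous F' ∧
      ∀ s, 0 < s → HasDerivAt (circleMoment p) (F' (√s) * (1 / (2 * √s))) s := by
  set N : ℂ → ℝ := fun w ↦ ‖w‖ ^ p with hN
  have hNc : ContDiff ℝ 1 N := contDiff_norm_rpow hp
  have hNd : Differentiable ℝ N := hNc.differentiable one_ne_zero
  have hNf : Continuous (fderiv ℝ N) := hNc.continuous_fderiv one_ne_zero
  set D : ℝ → Circle → ℝ := fun r z ↦ fderiv ℝ N (1 + (r : ℂ) * z) (z : ℂ) with hD
  have hDc : Continuous D.uncurry := by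
    simp only [hD, Function.uncurry_def]
    exact (hNf.comp (by fun_prop)).clm_apply (by fun_prop)
  have hdiff (z : Circle) (r : ℝ) :
      HasDerivAt (fun r : ℝ ↦ N (1 + (r : ℂ) * z)) (D r z) r := by
    have h1 : HasDerivAt (fun r : ℝ ↦ 1 + (r : ℂ) * z) (z : ℂ) r := by
      simpa using ((Complex.ofRealCLM.hasDerivAt (x := r)).mul_const (z : ℂ)).const_add 1
    exact (hNd _).hasFDerivAt.comp_hasDerivAt r h1
  have hF (r : ℝ) : HasDerivAt (fun r : ℝ ↦ ∫ z : Circle, N (1 + (r : ℂ) * z) ∂circleMeasure)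
      (∫ z, D r z ∂circleMeasure) r := by
    obtain ⟨K, hK⟩ := ((isCompact_closedBall r 1).prod
      (isCompact_univ (X := Circle))).exists_bound_of_continuousOn hDc.continuousOn
    have hcont (r : ℝ) : Continuous fun z : Circle ↦ N (1 + (r : ℂ) * z) :=
      hNc.continuous.comp (by fun_prop)
    refine (hasDerivAt_integral_of_dominated_loc_of_deriv_le (bound := fun _ ↦ K)
      (Metric.closedBall_mem_nhds r one_pos)
      (.of_forall fun r ↦ (hcont r).aestronglyMeasurable)
      (hcont r).integrable_circle ?_ (.of_forall fun z x hx ↦ hK (x, z) ⟨hx, trivial⟩)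
      (integrable_const _) (.of_forall fun z x _ ↦ hdiff z x)).2
    exact (hDc.comp (by fun_prop : Continuous fun z : Circle ↦ (r, z))).aestronglyMeasurable
  refine ⟨fun r ↦ ∫ z, D r z ∂circleMeasure, continuous_integral_circle hDc, fun s hs ↦ ?_⟩
  exact (hF (√s)).comp s (Real.hasDerivAt_sqrt hs.ne')

/-- For `p > 2` the `p`-th moment of `1 + √s ζ` is convex in `s`. -/
theorem convexOn_circleMoment {p : ℝ} (hp : 2 < p) :
    ConvexOn ℝ (Set.Ici 0) (circleMoment p) := by
  obtain ⟨F', hF', hd⟩ := hasDerivAt_circleMoment (p := p) (by linarith)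
  have hdiff {s : ℝ} (hs : 0 < s) : DifferentiableAt ℝ (circleMoment p) s :=
    (hd s hs).differentiableAt
  have hc1 : ContinuousAt (deriv (circleMoment p)) 1 := by
    have h1 : ContinuousAt (fun s ↦ F' (√s) * (1 / (2 * √s))) 1 :=
      (hF'.continuousAt.comp Real.continuous_sqrt.continuousAt).mul
        (ContinuousAt.div continuousAt_const (by fun_prop) (by simp))
    refine h1.congr ?_
    filter_upwards [lt_mem_nhds one_pos] with s hs using (hd s hs).deriv.symm
  have hlo : MonotoneOn (deriv (circleMoment p)) (Set.Ioo 0 1) :=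
    (convexOn_circleMoment_Ioo p).monotoneOn_deriv fun s hs ↦ hdiff hs.1
  have hhi : MonotoneOn (deriv (circleMoment p)) (Set.Ioi 1) :=
    (convexOn_circleMoment_Ioi hp).monotoneOn_deriv fun s hs ↦ hdiff (one_pos.trans hs)
  have hlo1 {s : ℝ} (h0 : 0 < s) (h1 : s < 1) :
      deriv (circleMoment p) s ≤ deriv (circleMoment p) 1 := by
    refine ge_of_tendsto (hc1.tendsto.mono_left (nhdsWithin_le_nhds (s := Set.Iio 1))) ?_
    filter_upwards [Ioo_mem_nhdsLT h1] with t ht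
    exact hlo ⟨h0, h1⟩ ⟨h0.trans ht.1, ht.2⟩ ht.1.le
  have hhi1 {s : ℝ} (h1 : 1 < s) :
      deriv (circleMoment p) 1 ≤ deriv (circleMoment p) s := by
    refine le_of_tendsto (hc1.tendsto.mono_left (nhdsWithin_le_nhds (s := Set.Ioi 1))) ?_
    filter_upwards [Ioo_mem_nhdsGT h1] with t ht
    exact hhi ht.1 h1 ht.2.le
  refine MonotoneOn.convexOn_of_deriv (convex_Ici 0)
    (continuous_circleMoment (by linarith)).continuousOn ?_ ?_
  · rw [interior_Ici]
    exact fun s hs ↦ (hdiff hs).differentiableWithinAt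
  · rw [interior_Ici]
    intro s hs t ht hst
    rcases lt_trichotomy s 1 with hs1 | rfl | hs1
    · rcases lt_trichotomy t 1 with ht1 | rfl | ht1
      · exact hlo ⟨hs, hs1⟩ ⟨ht, ht1⟩ hst
      · exact hlo1 hs hs1
      · exact (hlo1 hs hs1).trans (hhi1 ht1)
    · rcases hst.eq_or_lt with rfl | hst
      · rfl
      · exact hhi1 hst
    · exact hhi hs1 (hs1.trans_le hst) hst

/-! ### The standard complex Gaussian -/

/-- The standard complex Gaussian distribution, with density `π⁻¹ exp (-|z|²)`. -/
noncomputable def complexGaussian : Measure ℂ :=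
  volume.withDensity fun z ↦ ENNReal.ofReal (Real.pi⁻¹ * Real.exp (-‖z‖ ^ 2))

theorem integral_complexGaussian {E : Type*} [NormedAddCommGroup E] [NormedSpace ℝ E] (f : ℂ → E) :
    ∫ z, f z ∂complexGaussian = ∫ z : ℂ, (Real.pi⁻¹ * Real.exp (-‖z‖ ^ 2)) • f z := by
  rw [complexGaussian, integral_withDensity_eq_integral_toReal_smul (by fun_prop) (by simp)]
  refine integral_congr_ae (.of_forall fun z ↦ ?_)
  simp only
  rw [ENNReal.toReal_ofReal (by positivity)]

theorem integral_norm_rpow_complexGaussian {q : ℝ} (hq : -2 < q) :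
    ∫ z, ‖z‖ ^ q ∂complexGaussian = Real.Gamma (1 + q / 2) := by
  rw [integral_complexGaussian]
  have h := Complex.integral_rpow_mul_exp_neg_rpow (p := 2) (q := q) (by norm_num) hq
  simp only [Real.rpow_two] at h
  have h1 (z : ℂ) : (Real.pi⁻¹ * Real.exp (-‖z‖ ^ 2)) • ‖z‖ ^ q =
      Real.pi⁻¹ * (‖z‖ ^ q * Real.exp (-‖z‖ ^ 2)) := by rw [smul_eq_mul]; ring
  simp_rw [h1]
  rw [integral_const_mul, h, ← mul_assoc]
  have : Real.pi⁻¹ * (2 * Real.pi / 2) = 1 := by field_simp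
  rw [this, one_mul]
  congr 1
  ring

/-- The Bochner integral of a non-integrable function is 0 by convention, whereas the computed value
is a positive Gamma value. -/
theorem integrable_norm_rpow_complexGaussian {q : ℝ} (hq : -2 < q) :
    Integrable (fun z ↦ ‖z‖ ^ q) complexGaussian := by
  by_contra h
  have h1 := integral_norm_rpow_complexGaussian hq
  rw [integral_undef h] at h1
  exact (Real.Gamma_pos_of_pos (by linarith)).ne h1

instance : IsFiniteMeasure complexGaussian := by
  have h := integrable_norm_rpow_complexGaussian (q := 0) (by norm_num)
  simp only [Real.rpow_zero] at h
  exact (integrable_const_iff_isFiniteMeasure one_ne_zero).1 h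

instance : IsProbabilityMeasure complexGaussian := by
  have h := integral_norm_rpow_complexGaussian (q := 0) (by norm_num)
  simp only [Real.rpow_zero, integral_const, smul_eq_mul, mul_one, zero_div, add_zero,
    Real.Gamma_one] at h
  exact ⟨by rw [← ENNReal.toReal_eq_one_iff]; exact h⟩

theorem integral_norm_sq_complexGaussian : ∫ z, ‖z‖ ^ 2 ∂complexGaussian = 1 := by
  have h := integral_norm_rpow_complexGaussian (q := 2) (by norm_num)
  simp only [Real.rpow_two] at h
  rw [h, show (1 : ℝ) + 2 / 2 = 2 by norm_num, Real.Gamma_two]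

theorem charFun_complexGaussian (t : ℂ) :
    charFun complexGaussian t = Complex.exp (-(‖t‖ ^ 2 / 4)) := by
  rw [charFun_apply, integral_complexGaussian]
  have h := GaussianFourier.integral_cexp_neg_mul_sq_norm_add (b := 1) (by simp) Complex.I t
  have h1 (z : ℂ) : (Real.pi⁻¹ * Real.exp (-‖z‖ ^ 2)) • Complex.exp (inner ℝ z t * Complex.I) =
      (Real.pi : ℂ)⁻¹ * Complex.exp (-1 * ‖z‖ ^ 2 + Complex.I * inner ℝ t z) := by
    rw [Complex.exp_add, real_inner_comm, mul_comm Complex.I, Complex.real_smul]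
    push_cast
    rw [mul_assoc, neg_one_mul]
  simp_rw [h1]
  have hpi : (Real.pi : ℂ) ≠ 0 := by exact_mod_cast Real.pi_ne_zero
  rw [integral_const_mul, h, Complex.finrank_real_complex]
  simp only [Nat.cast_ofNat, div_one, mul_one, Complex.I_sq]
  rw [div_self two_ne_zero, Complex.cpow_one, ← mul_assoc, inv_mul_cancel₀ hpi, one_mul]
  congr 1
  ring

theorem charFun_map_mul_left (μ : Measure ℂ) (c t : ℂ) :
    charFun (μ.map fun z ↦ c * z) t = charFun μ ((starRingEnd ℂ) c * t) := by
  rw [charFun_apply, charFun_apply, integral_map (by fun_prop) (by fun_prop)]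
  refine integral_congr_ae (.of_forall fun z ↦ ?_)
  simp only [Complex.inner, map_mul]
  ring_nf

/-- The characteristic function at `t` depends only on `‖t‖`. -/
theorem measurePreserving_circle_mul_complexGaussian (u : Circle) :
    MeasurePreserving (fun z : ℂ ↦ (u : ℂ) * z) complexGaussian complexGaussian := by
  refine ⟨by fun_prop, ?_⟩
  have : IsProbabilityMeasure (complexGaussian.map fun z : ℂ ↦ (u : ℂ) * z) :=
    Measure.isProbabilityMeasure_map (by fun_prop)
  refine Measure.ext_of_charFun (funext fun t ↦ ?_)
  rw [charFun_map_mul_left, charFun_complexGaussian, charFun_complexGaussian, norm_mul,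
    Complex.norm_conj, Circle.norm_coe, one_mul]

/-! ### Comparison of one Steinhaus variable with a Gaussian -/

theorem Complex.exists_eq_norm_mul_circle (z : ℂ) : ∃ u : Circle, z = ‖z‖ * (u : ℂ) :=
  ⟨Circle.exp (Complex.arg z), by rw [Circle.coe_exp, Complex.norm_mul_exp_arg_mul_I]⟩

theorem integral_circle_norm_add_mul {p : ℝ} (a b : ℂ) (ha : a ≠ 0) :
    ∫ z : Circle, ‖a + b * z‖ ^ p ∂circleMeasure =
      ‖a‖ ^ p * circleMoment p (‖b‖ ^ 2 / ‖a‖ ^ 2) := by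
  obtain ⟨u, hu⟩ := Complex.exists_eq_norm_mul_circle (b / a)
  have h := integral_mul_left_eq_self (μ := circleMeasure)
    (fun z : Circle ↦ ‖1 + ‖b / a‖ * (z : ℂ)‖ ^ p) u
  rw [circleMoment, ← div_pow, ← norm_div, Real.sqrt_sq (norm_nonneg _), ← h, ← integral_const_mul]
  refine integral_congr_ae (.of_forall fun z ↦ ?_)
  simp only
  rw [← Real.mul_rpow (norm_nonneg _) (norm_nonneg _), ← norm_mul, Circle.coe_mul, ← mul_assoc,
    ← hu]
  congr 2
  field_simp

/-- Convexity in the squared radius of circular means of `‖a + ·‖ ^ p`. -/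
theorem convexOn_integral_circle_norm_add {p : ℝ} (hp : 2 < p) (a c : ℂ) :
    ConvexOn ℝ (Set.Ici 0) fun s : ℝ ↦ ∫ z : Circle, ‖a + c * √s * z‖ ^ p ∂circleMeasure := by
  rcases eq_or_ne a 0 with rfl | ha
  · have h1 : Set.EqOn (fun s : ℝ ↦ ‖c‖ ^ p * s ^ (p / 2))
        (fun s : ℝ ↦ ∫ z : Circle, ‖0 + c * √s * z‖ ^ p ∂circleMeasure) (Set.Ici 0) := by
      intro s hs
      simp only [zero_add, norm_mul, Circle.norm_coe, mul_one, integral_const, probReal_univ,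
        one_smul, Complex.norm_real, Real.norm_eq_abs, abs_of_nonneg (Real.sqrt_nonneg s)]
      rw [Real.mul_rpow (norm_nonneg _) (Real.sqrt_nonneg _), Real.sqrt_eq_rpow, ← Real.rpow_mul hs]
      congr 2
      exact (one_div_mul_eq_div 2 p).symm
    exact ((convexOn_rpow (by linarith : 1 ≤ p / 2)).smul (by positivity)).congr h1
  · have h1 : Set.EqOn (fun s : ℝ ↦ ‖a‖ ^ p * circleMoment p ((‖c‖ ^ 2 / ‖a‖ ^ 2) * s))
        (fun s : ℝ ↦ ∫ z : Circle, ‖a + c * √s * z‖ ^ p ∂circleMeasure) (Set.Ici 0) := by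
      intro s hs
      simp only
      rw [integral_circle_norm_add_mul _ _ ha, norm_mul, mul_pow, Complex.norm_real,
        Real.norm_eq_abs, sq_abs, Real.sq_sqrt hs]
      congr 2
      ring
    refine ConvexOn.congr (ConvexOn.smul (by positivity) ⟨convex_Ici 0, ?_⟩) h1
    intro x hx y hy α β hα hβ hαβ
    have hk : 0 ≤ ‖c‖ ^ 2 / ‖a‖ ^ 2 := by positivity
    have := (convexOn_circleMoment hp).2 (mul_nonneg hk hx) (mul_nonneg hk hy) hα hβ hαβ
    convert this using 2
    simp only [smul_eq_mul]
    ring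

theorem integrable_norm_add_mul_rpow_complexGaussian {p : ℝ} (hp : 1 ≤ p) (a c : ℂ) :
    Integrable (fun g ↦ ‖a + c * g‖ ^ p) complexGaussian := by
  have hint := integrable_norm_rpow_complexGaussian (q := p) (by linarith)
  refine Integrable.mono' (((integrable_const (‖a‖ ^ p)).add (hint.const_mul (‖c‖ ^ p))).const_mul
    (2 ^ (p - 1))) (Continuous.aestronglyMeasurable (Continuous.rpow_const (by fun_prop)
    fun _ ↦ Or.inr (by linarith))) (.of_forall fun g ↦ ?_)
  rw [Real.norm_of_nonneg (by positivity)]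
  have h2 : ‖a + c * g‖ ≤ ‖a‖ + ‖c‖ * ‖g‖ := (norm_add_le _ _).trans (by rw [norm_mul])
  refine (Real.rpow_le_rpow (norm_nonneg _) h2 (by linarith)).trans ?_
  have h3 : (‖a‖ + ‖c‖ * ‖g‖) ^ p ≤ 2 ^ (p - 1) * (‖a‖ ^ p + (‖c‖ * ‖g‖) ^ p) := by
    exact_mod_cast NNReal.rpow_add_le_mul_rpow_add_rpow ‖a‖₊ (‖c‖₊ * ‖g‖₊) hp
  rwa [Real.mul_rpow (norm_nonneg c) (norm_nonneg g)] at h3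

/-- The standard complex Gaussian is a mixture of uniform distributions on centred circles. -/
theorem integral_complexGaussian_eq_integral_circle {f : ℂ → ℝ} (hf : Continuous f)
    (hi : Integrable f complexGaussian) :
    Integrable (fun g : ℂ ↦ ∫ z : Circle, f (‖g‖ * z) ∂circleMeasure) complexGaussian ∧
    ∫ g, ∫ z : Circle, f (‖g‖ * z) ∂circleMeasure ∂complexGaussian = ∫ g, f g ∂complexGaussian := by
  -- Absorbing the phase of `g` into `z` turns the integrand into `f (z * g)`. After Fubini,
  -- rotation invariance of the Gaussian makes the inner integral independent of `z`.
  have h1 (g : ℂ) : ∫ z : Circle, f (‖g‖ * z) ∂circleMeasure =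
      ∫ z : Circle, f (z * g) ∂circleMeasure := by
    obtain ⟨u, hu⟩ := Complex.exists_eq_norm_mul_circle g
    rw [← integral_mul_left_eq_self (μ := circleMeasure) (fun z : Circle ↦ f (‖g‖ * z)) u]
    refine integral_congr_ae (.of_forall fun z ↦ ?_)
    simp only [Circle.coe_mul]
    rw [← mul_assoc, ← hu, mul_comm]
  have hemb (z : Circle) : MeasurableEmbedding fun g : ℂ ↦ (z : ℂ) * g :=
    (Homeomorph.mulLeft₀ (z : ℂ) (Circle.coe_ne_zero z)).measurableEmbedding
  have h2 (F : ℂ → ℝ) (z : Circle) :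
      ∫ g, F (z * g) ∂complexGaussian = ∫ g, F g ∂complexGaussian :=
    (measurePreserving_circle_mul_complexGaussian z).integral_comp (hemb z) F
  have hprod : Integrable (fun x : ℂ × Circle ↦ f (x.2 * x.1))
      (complexGaussian.prod circleMeasure) := by
    rw [integrable_prod_iff' (Continuous.aestronglyMeasurable (by fun_prop))]
    refine ⟨.of_forall fun z ↦ ?_, ?_⟩
    · exact ((measurePreserving_circle_mul_complexGaussian z).integrable_comp_emb (hemb z)).2 hi
    · simp only [h2 (fun w ↦ ‖f w‖)]
      exact integrable_const _
  simp_rw [h1]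
  refine ⟨hprod.integral_prod_left, ?_⟩
  rw [integral_integral_swap hprod]
  simp [h2 f]

/-- Replacing a uniform variable on the unit circle by a standard complex Gaussian increases
the `p`-th moment. -/
theorem integral_circle_le_integral_complexGaussian {p : ℝ} (hp : 2 < p) (a c : ℂ) :
    ∫ z : Circle, ‖a + c * z‖ ^ p ∂circleMeasure ≤ ∫ g, ‖a + c * g‖ ^ p ∂complexGaussian := by
  have hcont : Continuous fun g : ℂ ↦ ‖a + c * g‖ ^ p :=
    Continuous.rpow_const (by fun_prop) fun _ ↦ Or.inr (by linarith)
  obtain ⟨hi, he⟩ := integral_complexGaussian_eq_integral_circle hcont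
    (integrable_norm_add_mul_rpow_complexGaussian (by linarith) a c)
  have hsq : Integrable (fun g : ℂ ↦ ‖g‖ ^ 2) complexGaussian := by
    simpa using integrable_norm_rpow_complexGaussian (q := 2) (by norm_num)
  have hcomp : (fun s : ℝ ↦ ∫ z : Circle, ‖a + c * √s * z‖ ^ p ∂circleMeasure) ∘
      (fun g : ℂ ↦ ‖g‖ ^ 2) = fun g ↦ ∫ z : Circle, ‖a + c * (‖g‖ * z)‖ ^ p ∂circleMeasure := by
    funext g
    simp [Real.sqrt_sq (norm_nonneg g), mul_assoc]
  have hcs : Continuous fun s : ℝ ↦ ∫ z : Circle, ‖a + c * √s * z‖ ^ p ∂circleMeasure := by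
    refine continuous_integral_circle ?_
    refine Continuous.rpow_const ?_ fun _ ↦ Or.inr (by linarith)
    fun_prop
  -- Jensen's inequality for `s = ‖g‖ ^ 2`; the mean of `s` is 1, where the convex function is the
  -- original circular moment.
  have h := (convexOn_integral_circle_norm_add hp a c).map_integral_le hcs.continuousOn isClosed_Ici
    (μ := complexGaussian) (f := fun g ↦ ‖g‖ ^ 2) (.of_forall fun g ↦ sq_nonneg ‖g‖) hsq
    (by rwa [hcomp])
  rw [integral_norm_sq_complexGaussian] at h
  have h2 := congrArg (fun F ↦ ∫ g, F g ∂complexGaussian) hcomp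
  simp only [Function.comp_def] at h2
  rw [h2, he] at h
  simpa using h

theorem lintegral_circle_le_lintegral_complexGaussian {p : ℝ} (hp : 2 < p) (a c : ℂ) :
    ∫⁻ z : Circle, ‖a + c * z‖ₑ ^ p ∂circleMeasure ≤
      ∫⁻ g, ‖a + c * g‖ₑ ^ p ∂complexGaussian := by
  have hp0 : 0 ≤ p := by linarith
  have h1 (w : ℂ) : ‖w‖ₑ ^ p = ENNReal.ofReal (‖w‖ ^ p) := by
    rw [← ofReal_norm, ENNReal.ofReal_rpow_of_nonneg (norm_nonneg _) hp0]
  simp_rw [h1]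
  rw [← ofReal_integral_eq_lintegral_ofReal
      (Continuous.integrable_circle (Continuous.rpow_const (by fun_prop) fun _ ↦ Or.inr hp0))
      (.of_forall fun z ↦ by positivity),
    ← ofReal_integral_eq_lintegral_ofReal
      (integrable_norm_add_mul_rpow_complexGaussian (by linarith) a c)
      (.of_forall fun z ↦ by positivity)]
  exact ENNReal.ofReal_le_ofReal (integral_circle_le_integral_complexGaussian hp a c)

/-! ### Several variables and Gaussian linear combinations -/

theorem lintegral_pi_fin_succ {X : Type*} [MeasurableSpace X] (μ : Measure X) [SigmaFinite μ]
    {d : ℕ} {f : (Fin (d + 1) → X) → ℝ≥0∞} (hf : Measurable f) :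
    ∫⁻ x, f x ∂(Measure.pi fun _ ↦ μ) =
      ∫⁻ x, ∫⁻ y, f (Fin.cons x y) ∂(Measure.pi fun _ ↦ μ) ∂μ := by
  have h := (measurePreserving_piFinSuccAbove (fun _ : Fin (d + 1) ↦ μ) 0).symm
  rw [← h.lintegral_comp hf]
  refine (lintegral_prod (μ := μ) (ν := Measure.pi fun _ : Fin d ↦ μ) _
    (hf.comp h.measurable).aemeasurable).trans ?_
  simp [MeasurableEquiv.piFinSuccAbove_symm_apply, Fin.insertNthEquiv]

/-- Replacing independent Steinhaus variables by independent standard complex Gaussians increases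
the `p`-th moment of linear combinations. -/
theorem lintegral_torus_le_lintegral_complexGaussian {p : ℝ} (hp : 2 < p) {d : ℕ} (c : Fin d → ℂ)
    (a : ℂ) :
    ∫⁻ z : Fin d → Circle, ‖a + ∑ j, c j * z j‖ₑ ^ p ∂(Measure.pi fun _ ↦ circleMeasure) ≤
      ∫⁻ g : Fin d → ℂ, ‖a + ∑ j, c j * g j‖ₑ ^ p ∂(Measure.pi fun _ ↦ complexGaussian) := by
  induction d generalizing a with
  | zero => simp
  | succ d ih =>
    have hm : Measurable fun z : Fin (d + 1) → Circle ↦ ‖a + ∑ j, c j * (z j : ℂ)‖ₑ ^ p :=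
      (show Continuous fun z : Fin (d + 1) → Circle ↦
        a + ∑ j, c j * (z j : ℂ) by fun_prop).measurable.enorm.pow_const p
    have hm' (b : Fin d → ℂ) : Measurable fun x : Circle × (Fin d → ℂ) ↦
        ‖a + c 0 * x.1 + ∑ j, b j * x.2 j‖ₑ ^ p :=
      (show Continuous fun x : Circle × (Fin d → ℂ) ↦
        a + c 0 * x.1 + ∑ j, b j * x.2 j by fun_prop).measurable.enorm.pow_const p
    rw [lintegral_pi_fin_succ _ hm, lintegral_pi_fin_succ _ (by fun_prop)]
    simp only [Fin.sum_univ_succ, Fin.cons_zero, Fin.cons_succ, ← add_assoc]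
    -- For fixed `x`, the induction hypothesis with shift `a + c 0 * x` replaces the last `d`
    -- variables; after a swap, the one-variable comparison replaces `x` for fixed `g`.
    calc _ ≤ ∫⁻ x : Circle, ∫⁻ g : Fin d → ℂ, ‖a + c 0 * x + ∑ j : Fin d, c j.succ * g j‖ₑ ^ p
          ∂(Measure.pi fun _ ↦ complexGaussian) ∂circleMeasure :=
          lintegral_mono fun x ↦ ih (fun j ↦ c j.succ) (a + c 0 * x)
      _ = ∫⁻ g : Fin d → ℂ, ∫⁻ x : Circle, ‖a + c 0 * x + ∑ j : Fin d, c j.succ * g j‖ₑ ^ p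
          ∂circleMeasure ∂(Measure.pi fun _ ↦ complexGaussian) :=
          lintegral_lintegral_swap (hm' _).aemeasurable
      _ ≤ ∫⁻ g : Fin d → ℂ, ∫⁻ x : ℂ, ‖a + c 0 * x + ∑ j : Fin d, c j.succ * g j‖ₑ ^ p
          ∂complexGaussian ∂(Measure.pi fun _ ↦ complexGaussian) := by
          refine lintegral_mono fun g ↦ ?_
          simp only [add_right_comm a (c 0 * _)]
          exact lintegral_circle_le_lintegral_complexGaussian hp _ (c 0)
      _ = _ := lintegral_lintegral_swap (by fun_prop)

/-- The map `φ` lets the same factorization serve Gaussian sums (`φ` the identity) and Steinhaus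
sums (`φ` the inclusion of the circle). -/
theorem charFun_map_sum_mul_pi {X : Type*} [MeasurableSpace X] (μ : Measure X)
    [IsProbabilityMeasure μ] {φ : X → ℂ} (hφ : Measurable φ) {d : ℕ} (c : Fin d → ℂ) (t : ℂ) :
    charFun ((Measure.pi fun _ ↦ μ).map fun x : Fin d → X ↦ ∑ j, c j * φ (x j)) t =
      ∏ j, charFun (μ.map φ) ((starRingEnd ℂ) (c j) * t) := by
  rw [charFun_apply, integral_map (Measurable.aemeasurable (by fun_prop)) (by fun_prop)]
  simp_rw [← charFun_map_mul_left, Measure.map_map (measurable_const_mul _) hφ, charFun_apply]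
  have h (j : Fin d) : ∫ x, Complex.exp (inner ℝ x t * Complex.I)
      ∂(μ.map ((fun z ↦ c j * z) ∘ φ)) =
      ∫ x, Complex.exp (inner ℝ (c j * φ x) t * Complex.I) ∂μ := by
    rw [integral_map (by fun_prop) (by fun_prop)]
    rfl
  simp_rw [h]
  rw [← integral_fintype_prod_eq_prod
    (f := fun j x ↦ Complex.exp (inner ℝ (c j * φ x) t * Complex.I))]
  refine integral_congr_ae (.of_forall fun x ↦ ?_)
  simp only [sum_inner, Complex.ofReal_sum, Finset.sum_mul, Complex.exp_sum]

theorem map_sum_mul_complexGaussian {d : ℕ} (c : Fin d → ℂ) :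
    (Measure.pi fun _ ↦ complexGaussian).map (fun g : Fin d → ℂ ↦ ∑ j, c j * g j) =
      complexGaussian.map fun g ↦ (√(∑ j, ‖c j‖ ^ 2) : ℂ) * g := by
  have h1 : IsProbabilityMeasure
      ((Measure.pi fun _ ↦ complexGaussian).map fun g : Fin d → ℂ ↦ ∑ j, c j * g j) :=
    Measure.isProbabilityMeasure_map (Measurable.aemeasurable (by fun_prop))
  have h2 : IsProbabilityMeasure
      (complexGaussian.map fun g ↦ (√(∑ j, ‖c j‖ ^ 2) : ℂ) * g) :=
    Measure.isProbabilityMeasure_map (by fun_prop)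
  refine Measure.ext_of_charFun (funext fun t ↦ ?_)
  rw [charFun_map_sum_mul_pi complexGaussian (φ := fun z ↦ z) measurable_id, charFun_map_mul_left]
  simp only [Measure.map_id', charFun_complexGaussian, ← Complex.exp_sum, norm_mul,
    Complex.norm_conj, Complex.norm_real, Real.norm_eq_abs, abs_of_nonneg (Real.sqrt_nonneg _),
    ← Complex.ofReal_pow, mul_pow]
  rw [Real.sq_sqrt (Finset.sum_nonneg fun j _ ↦ by positivity)]
  congr 1
  push_cast
  rw [Finset.sum_mul, Finset.sum_div, Finset.sum_neg_distrib]

theorem lintegral_sum_mul_complexGaussian {p : ℝ} (hp : 0 ≤ p) {d : ℕ} (c : Fin d → ℂ) :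
    ∫⁻ g : Fin d → ℂ, ‖∑ j, c j * g j‖ₑ ^ p ∂(Measure.pi fun _ ↦ complexGaussian) =
      ENNReal.ofReal (√(∑ j, ‖c j‖ ^ 2) ^ p * Real.Gamma (1 + p / 2)) := by
  rw [← lintegral_map (f := fun z : ℂ ↦ ‖z‖ₑ ^ p) (by fun_prop) (by fun_prop),
    map_sum_mul_complexGaussian, lintegral_map (by fun_prop) (by fun_prop)]
  have h1 (w : ℂ) : ‖(√(∑ j, ‖c j‖ ^ 2) : ℂ) * w‖ₑ ^ p =
      ENNReal.ofReal (√(∑ j, ‖c j‖ ^ 2) ^ p * ‖w‖ ^ p) := by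
    rw [← ofReal_norm, ENNReal.ofReal_rpow_of_nonneg (norm_nonneg _) hp, norm_mul,
      Complex.norm_real, Real.norm_of_nonneg (Real.sqrt_nonneg _),
      Real.mul_rpow (Real.sqrt_nonneg _) (norm_nonneg _)]
  simp_rw [h1]
  rw [← ofReal_integral_eq_lintegral_ofReal
    ((integrable_norm_rpow_complexGaussian (by linarith)).const_mul _)
    (.of_forall fun z ↦ by positivity), integral_const_mul,
    integral_norm_rpow_complexGaussian (by linarith)]

/-! ### The inequality and membership in the Hardy space -/

theorem continuous_linearPoly {d : ℕ} (c : Fin d → ℂ) : Continuous (linearPoly c) := by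
  unfold linearPoly
  fun_prop

theorem hardyNorm_rpow {p : ℝ} (hp : 0 < p) {d : ℕ} (f : (Fin d → Circle) → ℂ) :
    hardyNorm f (ENNReal.ofReal p) =
      (∫⁻ z, ‖f z‖ₑ ^ p ∂torusMeasure d).toReal ^ (1 / p) := by
  rw [hardyNorm, eLpNorm_eq_lintegral_rpow_enorm_toReal (by simpa using hp) ENNReal.ofReal_ne_top,
    ENNReal.toReal_ofReal hp.le, ENNReal.toReal_rpow]

/-- The Khintchin inequality for Steinhaus variables. -/
theorem hardyNorm_linearPoly_le {p : ℝ} (hp : 2 < p) {d : ℕ} (c : Fin d → ℂ) :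
    hardyNorm (linearPoly c) (ENNReal.ofReal p) ≤
      Real.Gamma (1 + p / 2) ^ (1 / p) * √(∑ j, ‖c j‖ ^ 2) := by
  have hp0 : 0 < p := by linarith
  have h := lintegral_torus_le_lintegral_complexGaussian hp c 0
  simp only [zero_add] at h
  rw [lintegral_sum_mul_complexGaussian hp0.le] at h
  have hG : 0 < Real.Gamma (1 + p / 2) := Real.Gamma_pos_of_pos (by linarith)
  rw [hardyNorm_rpow hp0]
  have h2 := ENNReal.toReal_mono ENNReal.ofReal_ne_top h
  rw [ENNReal.toReal_ofReal (by positivity)] at h2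
  refine (Real.rpow_le_rpow ENNReal.toReal_nonneg h2 (by positivity)).trans (le_of_eq ?_)
  rw [Real.mul_rpow (by positivity) hG.le, ← Real.rpow_mul (Real.sqrt_nonneg _),
    mul_one_div_cancel hp0.ne', Real.rpow_one, mul_comm]

theorem memHardy_linearPoly {p : ℝ≥0∞} {d : ℕ} (c : Fin d → ℂ) : MemHardy (linearPoly c) p := by
  have hc := continuous_linearPoly c
  constructor
  · obtain ⟨K, hK⟩ := isCompact_univ.exists_bound_of_continuousOn hc.continuousOn
    exact MemLp.of_bound hc.aestronglyMeasurable K (.of_forall fun z ↦ hK z trivial)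
  · rintro α ⟨i, hi⟩
    have h1 (z : Fin d → Circle) : linearPoly c z * (starRingEnd ℂ) (torusMonomial α z) =
        ∑ j, c j * ∏ k, (z k : ℂ) ^ ((if k = j then 1 else 0) - α k) := by
      rw [linearPoly, Finset.sum_mul]
      refine Finset.sum_congr rfl fun j _ ↦ ?_
      rw [mul_assoc]
      congr 1
      simp only [sub_eq_add_neg, zpow_add₀ (Circle.coe_ne_zero _), Finset.prod_mul_distrib]
      congr 1
      · simp [apply_ite, Finset.prod_ite_eq']
      · rw [torusMonomial, map_prod]
        refine Finset.prod_congr rfl fun k _ ↦ ?_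
        rw [map_zpow₀, ← Circle.coe_inv_eq_conj, Circle.coe_inv, inv_zpow']
    have hint (j : Fin d) : Integrable (fun z : Fin d → Circle ↦
        c j * ∏ k, (z k : ℂ) ^ ((if k = j then 1 else 0) - α k)) (torusMeasure d) := by
      rw [← integrableOn_univ]
      refine ContinuousOn.integrableOn_compact isCompact_univ (Continuous.continuousOn ?_)
      refine continuous_const.mul (continuous_finsetProd _ fun k _ ↦ ?_)
      exact Continuous.zpow₀ (by fun_prop) _ fun z ↦ Or.inl (Circle.coe_ne_zero _)
    simp_rw [torusFourierCoeff, h1]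
    rw [integral_finsetSum _ fun j _ ↦ hint j]
    refine Finset.sum_eq_zero fun j _ ↦ ?_
    rw [integral_const_mul, torusMeasure, integral_fintype_prod_eq_prod
      (f := fun k (z : Circle) ↦ (z : ℂ) ^ ((if k = j then 1 else 0) - α k))]
    -- At the index `i` with `α i < 0` the exponent is at least 1, so that factor integrates to
    -- zero.
    rw [Finset.prod_eq_zero (Finset.mem_univ i), mul_zero]
    refine integral_circle_zpow ?_
    split_ifs <;> omega

/-! ### Central limit theorem and optimality -/

theorem integral_circle_re_of_continuous {f : Circle → ℂ} (hf : Continuous f) :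
    ∫ z, (f z).re ∂circleMeasure = (∫ z, f z ∂circleMeasure).re :=
  integral_re (𝕜 := ℂ) hf.integrable_circle

theorem integral_circle_re {c : ℂ} : ∫ z : Circle, (c * z).re ∂circleMeasure = 0 := by
  have h := integral_circle_zpow (n := 1) one_ne_zero
  have h1 : ∫ z : Circle, (c * z).re ∂circleMeasure = (∫ z : Circle, c * z ∂circleMeasure).re :=
    integral_circle_re_of_continuous (by fun_prop)
  simp only [zpow_one] at h
  rw [h1, integral_const_mul, h, mul_zero, Complex.zero_re]

theorem integral_circle_re_sq {c : ℂ} :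
    ∫ z : Circle, (c * z).re ^ 2 ∂circleMeasure = ‖c‖ ^ 2 / 2 := by
  have h := integral_circle_zpow (n := 2) two_ne_zero
  have h1 : ∫ z : Circle, (c ^ 2 * z ^ 2).re ∂circleMeasure =
      (∫ z : Circle, c ^ 2 * z ^ 2 ∂circleMeasure).re :=
    integral_circle_re_of_continuous (by fun_prop)
  rw [integral_const_mul] at h1
  have h2 : ∫ z : Circle, (z : ℂ) ^ 2 ∂circleMeasure = 0 := by exact_mod_cast h
  rw [h2, mul_zero, Complex.zero_re] at h1
  have h3 (z : Circle) : (c * z).re ^ 2 = ‖c‖ ^ 2 / 2 + (c ^ 2 * z ^ 2).re / 2 := by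
    have h4 : ‖c * z‖ ^ 2 = ‖c‖ ^ 2 := by rw [norm_mul, Circle.norm_coe, mul_one]
    rw [← h4, ← mul_pow]
    generalize c * (z : ℂ) = w
    rw [Complex.sq_norm, Complex.normSq_apply, sq w, Complex.mul_re]
    ring
  simp_rw [h3]
  rw [integral_add (integrable_const _) (Continuous.integrable_circle (by fun_prop)),
    integral_div _ (fun z : Circle ↦ (c ^ 2 * (z : ℂ) ^ 2).re), h1]
  simp

theorem tendsto_charFun_circle_pow (t : ℂ) :
    Tendsto (fun n : ℕ ↦ charFun (circleMeasure.map fun z : Circle ↦ (z : ℂ))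
      ((√n : ℂ)⁻¹ * t) ^ n) atTop (𝓝 (Complex.exp (-(‖t‖ ^ 2 / 4)))) := by
  have hmeas : Measurable fun z : Circle ↦ (z : ℂ) := Continuous.measurable (by fun_prop)
  rcases eq_or_ne t 0 with rfl | ht
  · have : IsProbabilityMeasure (circleMeasure.map fun z : Circle ↦ (z : ℂ)) :=
      Measure.isProbabilityMeasure_map hmeas.aemeasurable
    simp
  · have ht' : ‖t‖ ≠ 0 := norm_ne_zero_iff.2 ht
    -- Projecting onto the direction of `t` reduces to the real central limit theorem; the factor
    -- `√2` gives `Re(c z)` variance 1.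
    set c : ℂ := (√2 / ‖t‖ : ℝ) * (starRingEnd ℂ) t with hc
    have hcn : ‖c‖ ^ 2 = 2 := by
      rw [hc, norm_mul, Complex.norm_conj, Complex.norm_real, Real.norm_of_nonneg (by positivity),
        div_mul_cancel₀ _ ht', Real.sq_sqrt (by norm_num)]
    have hX : Measurable fun z : Circle ↦ (c * z).re := Continuous.measurable (by fun_prop)
    have h := ProbabilityTheory.tendsto_charFun_inv_sqrt_mul_pow (P := circleMeasure)
      (X := fun z : Circle ↦ (c * z).re) hX.aemeasurable integral_circle_re (by
        have := integral_circle_re_sq (c := c)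
        rw [hcn, div_self two_ne_zero] at this
        exact this) (‖t‖ / √2)
    have h2 : ((-((‖t‖ / √2 : ℝ) : ℂ) ^ 2 / 2) : ℂ) = -(‖t‖ ^ 2 / 4) := by
      have : (√2 : ℝ) ^ 2 = 2 := Real.sq_sqrt (by norm_num)
      rw [← Complex.ofReal_pow, div_pow, this]
      push_cast
      ring
    rw [h2] at h
    refine h.congr fun n ↦ ?_
    congr 1
    rw [charFun_apply_real, charFun_apply, integral_map hX.aemeasurable (by fun_prop),
      integral_map hmeas.aemeasurable (by fun_prop)]
    refine integral_congr_ae (.of_forall fun z ↦ ?_)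
    simp only
    congr 2
    rw [← Complex.ofReal_mul]
    congr 1
    have h3 : (c * z).re = √2 / ‖t‖ * ((starRingEnd ℂ) t * z).re := by
      rw [hc, mul_assoc, Complex.re_ofReal_mul]
    have h4 : inner ℝ (z : ℂ) ((√n : ℂ)⁻¹ * t) = (√n)⁻¹ * ((starRingEnd ℂ) t * z).re := by
      rw [Complex.inner, ← Complex.ofReal_inv, mul_assoc, Complex.re_ofReal_mul]
      congr 1
      simp only [Complex.mul_re, Complex.conj_re, Complex.conj_im]
      ring
    rw [h3, h4]
    have : √2 ≠ 0 := by positivity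
    field_simp

/-- The central limit theorem for Steinhaus variables. -/
theorem tendsto_integral_linearPoly_inv_sqrt (f : BoundedContinuousFunction ℂ ℝ) :
    Tendsto (fun n : ℕ ↦ ∫ z, f (linearPoly (fun _ : Fin n ↦ (√n : ℂ)⁻¹) z) ∂torusMeasure n) atTop
      (𝓝 (∫ g, f g ∂complexGaussian)) := by
  have hm (n : ℕ) : Measurable (linearPoly fun _ : Fin n ↦ (√n : ℂ)⁻¹) :=
    (continuous_linearPoly _).measurable
  set μ : ℕ → ProbabilityMeasure ℂ := fun n ↦
    ⟨(torusMeasure n).map (linearPoly fun _ : Fin n ↦ (√n : ℂ)⁻¹),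
      Measure.isProbabilityMeasure_map (hm n).aemeasurable⟩ with hμ
  have h : Tendsto μ atTop (𝓝 (⟨complexGaussian, inferInstance⟩ : ProbabilityMeasure ℂ)) := by
    refine ProbabilityMeasure.tendsto_of_tendsto_charFun fun t ↦ ?_
    simp only [ProbabilityMeasure.coe_mk, charFun_complexGaussian]
    refine (tendsto_charFun_circle_pow t).congr fun n ↦ ?_
    have := charFun_map_sum_mul_pi circleMeasure (φ := fun z : Circle ↦ (z : ℂ))
      (Continuous.measurable (by fun_prop)) (fun _ : Fin n ↦ (√n : ℂ)⁻¹) t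
    rw [Finset.prod_const, Finset.card_univ, Fintype.card_fin, map_inv₀, Complex.conj_ofReal] at this
    exact this.symm
  have h2 := ProbabilityMeasure.tendsto_iff_forall_integral_tendsto.1 h f
  refine h2.congr fun n ↦ ?_
  exact integral_map (hm n).aemeasurable f.continuous.aestronglyMeasurable

theorem integral_norm_rpow_eq_hardyNorm_rpow {p : ℝ} (hp : 0 < p) {d : ℕ} (c : Fin d → ℂ) :
    ∫ z, ‖linearPoly c z‖ ^ p ∂torusMeasure d = hardyNorm (linearPoly c) (ENNReal.ofReal p) ^ p := by
  rw [hardyNorm_rpow hp, ← Real.rpow_mul ENNReal.toReal_nonneg, one_div_mul_cancel hp.ne',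
    Real.rpow_one, integral_eq_lintegral_of_nonneg_ae (.of_forall fun z ↦ by positivity)
    (((continuous_linearPoly c).norm.rpow_const fun _ ↦ Or.inr hp.le).aestronglyMeasurable)]
  congr 1
  refine lintegral_congr fun z ↦ ?_
  rw [← ofReal_norm, ENNReal.ofReal_rpow_of_nonneg (norm_nonneg _) hp.le]

/-- Optimality of the constant in the Khintchin inequality for Steinhaus variables. -/
theorem gamma_rpow_le_of_hardyNorm_linearPoly_le {p : ℝ} (hp : 0 < p) {C : ℝ}
    (hC : ∀ d : ℕ, 1 ≤ d → ∀ c : Fin d → ℂ,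
      hardyNorm (linearPoly c) (ENNReal.ofReal p) ≤ C * √(∑ j, ‖c j‖ ^ 2)) :
    Real.Gamma (1 + p / 2) ^ (1 / p) ≤ C := by
  -- The `n` coefficients `n^{-1/2}` form a unit vector in `ℓ²`.
  have hn (n : ℕ) (h : 1 ≤ n) :
      hardyNorm (linearPoly fun _ : Fin n ↦ (√n : ℂ)⁻¹) (ENNReal.ofReal p) ≤ C := by
    have h1 := hC n h fun _ ↦ (√n : ℂ)⁻¹
    have h2 : (n : ℝ) ≠ 0 := by positivity
    simpa [h2] using h1
  have hC0 : 0 ≤ C := ENNReal.toReal_nonneg.trans (hn 1 le_rfl)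
  have hcont : Continuous fun g : ℂ ↦ ‖g‖ ^ p := continuous_norm.rpow_const fun _ ↦ Or.inr hp.le
  have hint := integrable_norm_rpow_complexGaussian (q := p) (by linarith)
  -- Weak convergence tests only bounded continuous functions, hence the truncation at `M`, which is
  -- removed afterwards by dominated convergence.
  have hM (M : ℕ) : ∫ g, min (‖g‖ ^ p) (M : ℝ) ∂complexGaussian ≤ C ^ p := by
    set f : BoundedContinuousFunction ℂ ℝ := BoundedContinuousFunction.ofNormedAddCommGroup
      (fun g ↦ min (‖g‖ ^ p) (M : ℝ)) (hcont.min continuous_const) M (fun g ↦ by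
        rw [Real.norm_of_nonneg (by positivity)]
        exact min_le_right _ _) with hf
    refine le_of_tendsto (tendsto_integral_linearPoly_inv_sqrt f) ?_
    filter_upwards [eventually_ge_atTop 1] with n h1
    have hc := continuous_linearPoly fun _ : Fin n ↦ (√n : ℂ)⁻¹
    have hi (F : (Fin n → Circle) → ℝ) (hF : Continuous F) : Integrable F (torusMeasure n) := by
      rw [← integrableOn_univ]
      exact hF.continuousOn.integrableOn_compact isCompact_univ
    calc _ ≤ ∫ z, ‖linearPoly (fun _ : Fin n ↦ (√n : ℂ)⁻¹) z‖ ^ p ∂torusMeasure n :=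
          integral_mono (hi _ (f.continuous.comp hc)) (hi _ (hcont.comp hc))
            fun z ↦ min_le_left _ _
      _ = _ := integral_norm_rpow_eq_hardyNorm_rpow hp _
      _ ≤ C ^ p := Real.rpow_le_rpow ENNReal.toReal_nonneg (hn n h1) hp.le
  have hlim : Tendsto (fun M : ℕ ↦ ∫ g, min (‖g‖ ^ p) (M : ℝ) ∂complexGaussian) atTop
      (𝓝 (∫ g, ‖g‖ ^ p ∂complexGaussian)) := by
    refine tendsto_integral_of_dominated_convergence (fun g ↦ ‖g‖ ^ p)
      (fun M ↦ (hcont.min continuous_const).aestronglyMeasurable) hint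
      (fun M ↦ .of_forall fun g ↦ ?_) (.of_forall fun g ↦ ?_)
    · rw [Real.norm_of_nonneg (by positivity)]
      exact min_le_left _ _
    · refine tendsto_const_nhds.congr' ?_
      filter_upwards [eventually_ge_atTop ⌈‖g‖ ^ p⌉₊] with M hM
      exact (min_eq_left (Nat.ceil_le.1 hM)).symm
  have h := le_of_tendsto' hlim hM
  rw [integral_norm_rpow_complexGaussian (by linarith)] at h
  have hG : 0 < Real.Gamma (1 + p / 2) := Real.Gamma_pos_of_pos (by linarith)
  refine (Real.rpow_le_rpow hG.le h (by positivity)).trans (le_of_eq ?_)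
  rw [← Real.rpow_mul hC0, mul_one_div_cancel hp.ne', Real.rpow_one]

theorem mainTheorem5 (p : ℝ) (hp : 2 < p) :
    (∀ d : ℕ, 1 ≤ d → ∀ c : Fin d → ℂ,
      MemHardy (linearPoly c) (ENNReal.ofReal p) ∧
      hardyNorm (linearPoly c) (ENNReal.ofReal p) ≤
        Real.Gamma (1 + p / 2) ^ (1 / p) * Real.sqrt (∑ j, ‖c j‖ ^ 2)) ∧
    (∀ C : ℝ,
      (∀ d : ℕ, 1 ≤ d → ∀ c : Fin d → ℂ,
        hardyNorm (linearPoly c) (ENNReal.ofReal p) ≤ C * Real.sqrt (∑ j, ‖c j‖ ^ 2)) →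
      Real.Gamma (1 + p / 2) ^ (1 / p) ≤ C) :=
  ⟨fun _ _ c ↦ ⟨memHardy_linearPoly c, hardyNorm_linearPoly_le hp c⟩,
    fun _ hC ↦ gamma_rpow_le_of_hardyNorm_linearPoly_le (by linarith) hC⟩
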